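/- All rings are commutative. Let $(R,\mathfrak m)$ be a Noetherian local ring of Krull dimension two, and let $M$ be a nonzero finitely generated torsion-free $R$-module, i.e. every non-zero-divisor of $R$ is a non-zero-divisor on $M$ (for instance, $M$ may be a nonzero ideal of $R$). If $M$ has finite injective dimension and finite reducing Gorenstein dimension, then $R$ is Gorenstein. Here a finitely generated $R$-module $X$ is *totally reflexive* if the canonical map $X\to X^{**}$ is bijective, where $(-)^*=\operatorname{Hom}_R(-,R)$, and $\operatorname{Ext}^i_R(X,R)=0=\operatorname{Ext}^i_R(X^*,R)$ for all $i\ge 1$. A finitely generated $R$-module $K$ has *finite Gorenstein dimension* if there is an exact sequence $0\to X_n\to\cdots\to X_0\to K\to 0$ for some $n\ge 0$ with every $X_i$ totally reflexive. For $n\ge 0$, $\Omega^nK$ denotes the $n$-th syzygy of $K$ in a minimal free resolution. The module $M$ has *finite reducing Gorenstein dimension* if there are an integer $r\ge 0$, finitely generated $R$-modules $K_0,\dots,K_r$ with $K_0=M$ and $K_r$ of finite Gorenstein dimension, positive integers $a_i,b_i,n_i$, and short exact sequences $$0\to K_{i-1}^{\oplus a_i}\to K_i\to (\Omega^{n_i}K_{i-1})^{\oplus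 b_i}\to 0\qquad (1\le i\le r).$$ The ring $R$ is *Gorenstein* if it has finite injective dimension as a module over itself. -/

import Mathlib

open CategoryTheory

universe u

section GorensteinDefinitions

variable (R : Type u) [CommRing R]

/-- The `R`-module `M` has finite injective dimension. -/
def HasFiniteInjectiveDimension (M : Type u) [AddCommGroup M] [Module R M] : Prop :=
  ∃ n : ℕ, HasInjectiveDimensionLE (ModuleCat.of R M) n

/-- A commutative Noetherian local ring is Gorenstein if it has finite injective dimension as a
module over itself. -/
structure IsGorensteinLocalRing : Prop where
  isNoetherianRing : IsNoetherianRing R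
  isLocalRing : IsLocalRing R
  hasFiniteInjectiveDimension : HasFiniteInjectiveDimension R R

/-- A finitely generated module `M` is totally reflexive if the biduality map `M → M**` is bijective
and `Ext^i(M, R) = 0 = Ext^i(M*, R)` for all `i ≥ 1`. -/
structure IsTotallyReflexive (M : Type u) [AddCommGroup M] [Module R M] : Prop where
  finite : Module.Finite R M
  isReflexive : Module.IsReflexive R M
  ext_eq_zero : ∀ i : ℕ, 1 ≤ i →
    Subsingleton (Abelian.Ext (ModuleCat.of R M) (ModuleCat.of R R) i)
  ext_dual_eq_zero : ∀ i : ℕ, 1 ≤ i →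
    Subsingleton (Abelian.Ext (ModuleCat.of R (Module.Dual R M)) (ModuleCat.of R R) i)

/-- `HasGorensteinDimensionLE R n M`: there is an exact sequence
`0 → X_n → ⋯ → X_0 → M → 0` in which every `X_i` is totally reflexive. The sequence is given by its
first map `X_0 → M` and by an exact sequence of length `n - 1` that resolves the kernel. -/
def HasGorensteinDimensionLE : ℕ → ∀ (M : Type u) [AddCommGroup M] [Module R M], Prop
  | 0 => fun M _ _ => IsTotallyReflexive R M
  | n + 1 => fun M _ _ =>
      ∃ (X : ModuleCat.{u} R) (f : X →ₗ[R] M), IsTotallyReflexive R X ∧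
        Function.Surjective f ∧ HasGorensteinDimensionLE n (LinearMap.ker f)

/-- The `R`-module `M` has finite Gorenstein dimension. -/
def HasFiniteGorensteinDimension (M : Type u) [AddCommGroup M] [Module R M] : Prop :=
  ∃ n : ℕ, HasGorensteinDimensionLE R n M

variable [IsLocalRing R]

/-- `IsSyzygy R n M N`: the module `N` is (isomorphic to) the `n`-th syzygy `Ω^n M` of `M` in a
minimal free resolution. A finite free cover `R^m → M` is minimal if its kernel is contained in
`𝔪 R^m`; then the kernel is `Ω M`, and `Ω^{n+1} M = Ω^n (Ω M)`. -/
def IsSyzygy : ℕ → ∀ (M : Type u) [AddCommGroup M] [Module R M]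
    (N : Type u) [AddCommGroup N] [Module R N], Prop
  | 0 => fun M _ _ N _ _ => Nonempty (M ≃ₗ[R] N)
  | n + 1 => fun M _ _ N _ _ =>
      ∃ (m : ℕ) (f : (Fin m → R) →ₗ[R] M), Function.Surjective f ∧
        LinearMap.ker f ≤ IsLocalRing.maximalIdeal R • (⊤ : Submodule R (Fin m → R)) ∧
        IsSyzygy n (LinearMap.ker f) N

/-- `IsReducingStep R K L`: for some positive integers `a`, `b`, `n` there is a short exact sequence
`0 → K^a → L → (Ω^n K)^b → 0`. -/
def IsReducingStep (K L : Type u) [AddCommGroup K] [Module R K] [AddCommGroup L] [Module R L] :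
    Prop :=
  ∃ (a b n : ℕ) (S : ModuleCat.{u} R) (f : (Fin a → K) →ₗ[R] L) (g : L →ₗ[R] (Fin b → S)),
    0 < a ∧ 0 < b ∧ 0 < n ∧ IsSyzygy R n K S ∧
      Function.Injective f ∧ Function.Exact f g ∧ Function.Surjective g

/-- `K_0, …, K_r` is a reducing sequence of `M` for the Gorenstein dimension: a sequence of finitely
generated modules with `K_0 = M` (up to isomorphism), with each `K_{i+1}` obtained from `K_i` by a
reducing step, and with `K_r` of finite Gorenstein dimension. -/
structure IsReducingGorensteinSequence (M : Type u) [AddCommGroup M] [Module R M]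
    (r : ℕ) (K : Fin (r + 1) → ModuleCat.{u} R) : Prop where
  finite : ∀ i, Module.Finite R (K i)
  zero : Nonempty (K 0 ≃ₗ[R] M)
  step : ∀ i : Fin r, IsReducingStep R (K i.castSucc) (K i.succ)
  last : HasFiniteGorensteinDimension R (K (Fin.last r))

/-- The reducing Gorenstein dimension of `M`, the infimum of all `r` for which `M` has a reducing
sequence `K_0, …, K_r` (and `⊤` if there is none). -/
noncomputable def reducingGorensteinDimension (M : Type u) [AddCommGroup M] [Module R M] : ℕ∞ :=
  ⨅ (r : ℕ) (_ : ∃ K : Fin (r + 1) → ModuleCat.{u} R, IsReducingGorensteinSequence R M r K),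
    (r : ℕ∞)

end GorensteinDefinitions

/-!
Let `k` be the residue field of `R`. The proof shows that `M` has projective dimension at most one
and transfers the vanishing of `Ext^i(k, M)` for large `i` from `M` to `R`.

*Vanishing.* For finitely generated `M`, the vanishing of `Ext^i(k, M)` for all `i ≥ n` implies that
of `Ext^i(N, M)` for all finitely generated `N` and all `i ≥ n` (`extVanishes_of_residueField`).
Since `k` embeds in the quotient of `R` by a regular sequence, which has length at most two, this
gives `Ext^i(N, M) = 0` for `i > 2` when `M` has finite injective dimension, and Nakayama's lemma
improves this to `Ext^i(K, M) = 0` for `i ≥ 2` when `K` is torsion-free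
(`extVanishes_of_isTorsionFree`). No Cohen–Macaulay property of `R` is needed.

*Reducing sequences split off `M`.* All modules in a reducing sequence `K_0 = M, …, K_r` are
torsion-free, as a syzygy `Ω^n K` with `n ≥ 1` is a submodule of a free module. Hence
`Ext^1(Ω^n K_i, M) = Ext^{n+1}(K_i, M) = 0`, retractions onto `M` extend along the sequence, and
`M` is a retract of `K_r` (`IsReducingGorensteinSequence.exists_retract_last`).

*Finite projective dimension.* The module `K_r` of finite Gorenstein dimension embeds in a module
`H` of finite projective dimension with totally reflexive cokernel `G` (`exists_hull`). Totally
reflexive modules are syzygies of arbitrarily high order, so `Ext^1(G, M) = 0` and the retraction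
`K_r → M` extends to `H`. Thus `M` is a retract of `H`
(`exists_hasProjectiveDimensionLE_of_retract`).

*Conclusion.* Since `Ext^i(M, M) = 0` for `i ≥ 2`, the first syzygy of `M` is free
(`free_of_extVanishes`). In the minimal resolution `0 → N → F → M → 0` the map `N → F` vanishes on
`Ext^i(k, -)`, so `Ext^i(k, F)` embeds in `Ext^i(k, M)`, which is zero for large `i`. Therefore
`Ext^i(k, R) = 0` for large `i`, and `R` has finite injective dimension.
-/

/-! ### Vanishing of Ext along short exact sequences -/

section ExtVanishing

open Abelian

variable {R : Type u} [CommRing R]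

variable (R) in
/-- `Ext^i(A, B) = 0`, for `R`-modules `A` and `B`. -/
abbrev ExtVanishes (A B : Type u) [AddCommGroup A] [Module R A] [AddCommGroup B] [Module R B]
    (i : ℕ) : Prop :=
  Subsingleton (Ext (ModuleCat.of R A) (ModuleCat.of R B) i)

variable {A B C M N : Type u} [AddCommGroup A] [Module R A] [AddCommGroup B] [Module R B]
  [AddCommGroup C] [Module R C] [AddCommGroup M] [Module R M] [AddCommGroup N] [Module R N]

lemma hasProjectiveDimensionLE_zero_of_projective [Module.Projective R A] :
    HasProjectiveDimensionLE (ModuleCat.of R A) 0 :=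
  projective_iff_hasProjectiveDimensionLT_one.mp ((IsProjective.iff_projective A).mp inferInstance)

/-- The short complex in `ModuleCat R` given by an exact pair of linear maps. -/
abbrev shortComplexOfExact (f : A →ₗ[R] B) (g : B →ₗ[R] C) (h : Function.Exact f g) :
    ShortComplex (ModuleCat.{u} R) :=
  ModuleCat.shortComplexOfCompEqZero f g h.linearMap_comp_eq_zero

variable {f : A →ₗ[R] B} {g : B →ₗ[R] C}

lemma shortExact_shortComplexOfExact (hf : Function.Injective f) (h : Function.Exact f g)
    (hg : Function.Surjective g) : (shortComplexOfExact f g h).ShortExact :=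
  ModuleCat.shortComplex_shortExact _ h hf hg

namespace ExtVanishes

lemma mid (hf : Function.Injective f) (h : Function.Exact f g) (hg : Function.Surjective g)
    {i : ℕ} (hA : ExtVanishes R A M i) (hC : ExtVanishes R C M i) : ExtVanishes R B M i := by
  refine subsingleton_of_forall_eq 0 fun e => ?_
  obtain ⟨x, rfl⟩ := Ext.contravariant_sequence_exact₂ (shortExact_shortComplexOfExact hf h hg) _ e
    (hA.elim _ _)
  rw [hC.elim x 0, Ext.comp_zero]

lemma left (hf : Function.Injective f) (h : Function.Exact f g) (hg : Function.Surjective g)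
    {i : ℕ} (hB : ExtVanishes R B M i) (hC : ExtVanishes R C M (i + 1)) : ExtVanishes R A M i := by
  refine subsingleton_of_forall_eq 0 fun e => ?_
  obtain ⟨x, rfl⟩ := Ext.contravariant_sequence_exact₁ (shortExact_shortComplexOfExact hf h hg) _ e
    (add_comm 1 i) (hC.elim _ _)
  rw [hB.elim x 0, Ext.comp_zero]

lemma right (hf : Function.Injective f) (h : Function.Exact f g) (hg : Function.Surjective g)
    {i : ℕ} (hA : ExtVanishes R A M i) (hB : ExtVanishes R B M (i + 1)) :
    ExtVanishes R C M (i + 1) := by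
  refine subsingleton_of_forall_eq 0 fun e => ?_
  obtain ⟨x, rfl⟩ := Ext.contravariant_sequence_exact₃ (shortExact_shortComplexOfExact hf h hg) _ e
    (hB.elim _ _) (add_comm 1 i)
  rw [hA.elim x 0, Ext.comp_zero]

lemma covariant_right (hf : Function.Injective f) (h : Function.Exact f g)
    (hg : Function.Surjective g) {i : ℕ} (hB : ExtVanishes R M B i)
    (hA : ExtVanishes R M A (i + 1)) : ExtVanishes R M C i := by
  refine subsingleton_of_forall_eq 0 fun e => ?_
  obtain ⟨x, rfl⟩ := Ext.covariant_sequence_exact₃ _ (shortExact_shortComplexOfExact hf h hg) e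
    rfl (hA.elim _ _)
  rw [hB.elim x 0, Ext.zero_comp]

/-- `Ext^i(-, M)` vanishes on a retract of a module on which it vanishes. -/
lemma of_retract (ι : A →ₗ[R] B) (ρ : B →ₗ[R] A) (h : ρ ∘ₗ ι = .id) {i : ℕ}
    (hB : ExtVanishes R B M i) : ExtVanishes R A M i := by
  refine subsingleton_of_forall_eq 0 fun e => ?_
  have : (Ext.mk₀ (ModuleCat.ofHom ι)).comp
      ((Ext.mk₀ (ModuleCat.ofHom ρ)).comp e (zero_add i)) (zero_add i) = e := by
    rw [Ext.mk₀_comp_mk₀_assoc, ← ModuleCat.ofHom_comp, h]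
    exact Ext.mk₀_id_comp e
  rw [← this, hB.elim (Ext.comp _ e _) 0, Ext.comp_zero]

/-- `Ext^i(M, -)` vanishes on a retract of a module on which it vanishes. -/
lemma covariant_of_retract (ι : A →ₗ[R] B) (ρ : B →ₗ[R] A) (h : ρ ∘ₗ ι = .id) {i : ℕ}
    (hB : ExtVanishes R M B i) : ExtVanishes R M A i := by
  refine subsingleton_of_forall_eq 0 fun e => ?_
  have : (e.comp (Ext.mk₀ (ModuleCat.ofHom ι)) (add_zero i)).comp
      (Ext.mk₀ (ModuleCat.ofHom ρ)) (add_zero i) = e := by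
    rw [Ext.comp_assoc_of_second_deg_zero, Ext.mk₀_comp_mk₀, ← ModuleCat.ofHom_comp, h]
    exact Ext.comp_mk₀_id e
  rw [← this, hB.elim (e.comp _ _) 0, Ext.zero_comp]

lemma of_equiv (e : A ≃ₗ[R] B) {i : ℕ} (hB : ExtVanishes R B M i) : ExtVanishes R A M i :=
  of_retract e.toLinearMap e.symm.toLinearMap (by ext; simp) hB

lemma of_projective [Module.Projective R A] (i : ℕ) : ExtVanishes R A M (i + 1) := by
  have : Projective (ModuleCat.of R A) := (IsProjective.iff_projective A).mp inferInstance
  exact Ext.subsingleton_of_projective _ _ i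

lemma of_subsingleton [Subsingleton A] (i : ℕ) : ExtVanishes R A M i := by
  refine subsingleton_of_forall_eq 0 fun e => ?_
  rw [← Ext.mk₀_id_comp e, (ModuleCat.isZero_of_subsingleton (ModuleCat.of R A)).eq_of_src (𝟙 _) 0,
    Ext.mk₀_zero, Ext.zero_comp]

lemma of_hasInjectiveDimensionLE {n i : ℕ} (h : HasInjectiveDimensionLE (ModuleCat.of R M) n)
    (hi : n < i) : ExtVanishes R A M i :=
  HasInjectiveDimensionLT.subsingleton _ (n + 1) i hi _

lemma of_hasProjectiveDimensionLE {n i : ℕ} (h : HasProjectiveDimensionLE (ModuleCat.of R A) n)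
    (hi : n < i) : ExtVanishes R A M i :=
  HasProjectiveDimensionLT.subsingleton _ (n + 1) i hi _

/-- If `Ext^1(C, M) = 0`, then linear maps to `M` extend along an injection with cokernel `C`. -/
lemma exists_extension (hf : Function.Injective f) (h : Function.Exact f g)
    (hg : Function.Surjective g) (hC : ExtVanishes R C M 1) (φ : A →ₗ[R] M) :
    ∃ ψ : B →ₗ[R] M, ψ ∘ₗ f = φ := by
  obtain ⟨x, hx⟩ := Ext.contravariant_sequence_exact₁ (shortExact_shortComplexOfExact hf h hg)
    (ModuleCat.of R M) (Ext.mk₀ (ModuleCat.ofHom φ)) (add_zero 1) (hC.elim _ _)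
  obtain ⟨y, rfl⟩ := Ext.addEquiv₀.symm.surjective x
  refine ⟨y.hom, ?_⟩
  have hx' : Ext.mk₀ (ModuleCat.ofHom f ≫ y) = Ext.mk₀ (ModuleCat.ofHom φ) := by
    rw [← hx]
    exact (Ext.mk₀_comp_mk₀ _ _).symm
  have := Ext.addEquiv₀.symm.injective hx'
  simpa using congrArg ModuleCat.Hom.hom this

/-- If linear maps to `M` extend from `A` to `B` and `Ext^1(B, M) = 0`, then
`Ext^1(B / A, M) = 0`. -/
lemma one_of_exists_extension (hf : Function.Injective f) (h : Function.Exact f g)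
    (hg : Function.Surjective g) (hB : ExtVanishes R B M 1)
    (hext : ∀ φ : A →ₗ[R] M, ∃ ψ : B →ₗ[R] M, ψ ∘ₗ f = φ) : ExtVanishes R C M 1 := by
  refine subsingleton_of_forall_eq 0 fun e => ?_
  have hS := shortExact_shortComplexOfExact hf h hg
  obtain ⟨x, rfl⟩ := Ext.contravariant_sequence_exact₃ hS _ e (hB.elim _ _) (add_zero 1)
  obtain ⟨y, rfl⟩ := Ext.addEquiv₀.symm.surjective x
  obtain ⟨ψ, hψ⟩ := hext y.hom
  have hy : y = ModuleCat.ofHom f ≫ ModuleCat.ofHom ψ := by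
    rw [← ModuleCat.ofHom_comp, hψ]; rfl
  have : Ext.addEquiv₀.symm y =
      (Ext.mk₀ (ModuleCat.ofHom f)).comp (Ext.mk₀ (ModuleCat.ofHom ψ)) (zero_add 0) := by
    rw [hy]
    exact (Ext.mk₀_comp_mk₀ _ _).symm
  rw [this]
  exact hS.extClass_comp_assoc _

/-- If `x ∈ 𝔪` is a nonzerodivisor on `A` and `Ext^{i+1}(A/xA, M) = 0`, then multiplication by `x`
is surjective on the finitely generated module `Ext^i(A, M)`, which vanishes by Nakayama's lemma. -/
lemma of_regular_quotient [IsNoetherianRing R] [IsLocalRing R] [Module.Finite R A]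
    [Module.Finite R M] {x : R} (hx : x ∈ IsLocalRing.maximalIdeal R) (hreg : IsSMulRegular A x)
    (g : A →ₗ[R] C) (hg : Function.Surjective g)
    (h : Function.Exact (x • LinearMap.id : A →ₗ[R] A) g) {i : ℕ}
    (hC : ExtVanishes R C M (i + 1)) : ExtVanishes R A M i := by
  have hS := shortExact_shortComplexOfExact (f := (x • LinearMap.id : A →ₗ[R] A))
    (fun a b hab => hreg (by simpa using hab)) h hg
  have key : ∀ e : Ext (ModuleCat.of R A) (ModuleCat.of R M) i, ∃ y, x • y = e := fun e => by
    obtain ⟨y, hy⟩ := Ext.contravariant_sequence_exact₁ hS _ e (add_comm 1 i) (hC.elim _ _)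
    refine ⟨y, ?_⟩
    rw [← hy]
    have : ModuleCat.ofHom (x • LinearMap.id : A →ₗ[R] A) = x • 𝟙 (ModuleCat.of R A) := rfl
    change _ = (Ext.mk₀ (ModuleCat.ofHom (x • LinearMap.id : A →ₗ[R] A))).comp y _
    rw [this, Ext.mk₀_smul, Ext.smul_comp, Ext.mk₀_id_comp]
  have : (⊤ : Submodule R (Ext (ModuleCat.of R A) (ModuleCat.of R M) i)) ≤
      IsLocalRing.maximalIdeal R • ⊤ := fun e _ => by
    obtain ⟨y, rfl⟩ := key e
    exact Submodule.smul_mem_smul hx trivial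
  have := Submodule.eq_bot_of_le_smul_of_le_jacobson_bot (IsLocalRing.maximalIdeal R) ⊤
    Module.Finite.fg_top this (IsLocalRing.maximalIdeal_le_jacobson _)
  exact (Submodule.subsingleton_iff R).mp (subsingleton_of_top_eq_bot this)

end ExtVanishes

end ExtVanishing

/-! ### Detecting vanishing of Ext on the residue field -/

section Detection

variable {R : Type u} [CommRing R]

/-- Injective dimension is detected by the cyclic modules `R/I` (Baer's criterion and dimension
shifting). -/
lemma hasInjectiveDimensionLE_of_extVanishes_quotient (n : ℕ) :
    ∀ (M : Type u) [AddCommGroup M] [Module R M],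
      (∀ I : Ideal R, ExtVanishes R (R ⧸ I) M (n + 1)) →
      HasInjectiveDimensionLE (ModuleCat.of R M) n := by
  induction n with
  | zero =>
    intro M _ _ hM
    have hinj : Module.Injective R M := by
      refine Module.Baer.injective ((Module.Baer.iff_surjective).mpr fun I φ => ?_)
      obtain ⟨ψ, hψ⟩ := ExtVanishes.exists_extension (f := I.subtype) (g := I.mkQ)
        I.injective_subtype (LinearMap.exact_subtype_mkQ I) I.mkQ_surjective (hM I) φ
      exact ⟨ψ, hψ⟩
    exact injective_iff_hasInjectiveDimensionLT_one.mp
      (Module.injective_object_of_injective_module R M)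
  | succ n ih =>
    intro M _ _ hM
    obtain ⟨J, _, f, _⟩ := (EnoughInjectives.presentation (ModuleCat.of R M)).some
    have hf : Function.Injective f.hom := (ModuleCat.mono_iff_injective f).mp ‹_›
    have hS := shortExact_shortComplexOfExact hf f.hom.exact_map_mkQ_range
      (Submodule.mkQ_surjective _)
    have hJ : HasInjectiveDimensionLT (ModuleCat.of R J) 1 :=
      injective_iff_hasInjectiveDimensionLT_one.mp ‹Injective J›
    refine (hS.hasInjectiveDimensionLT_X₃_iff n ‹Injective J›).mp (ih _ fun I => ?_)
    exact ExtVanishes.covariant_right (A := M) hf f.hom.exact_map_mkQ_range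
      (Submodule.mkQ_surjective _)
      (ExtVanishes.of_hasInjectiveDimensionLE hJ (Nat.succ_pos n)) (hM I)

variable [IsNoetherianRing R] [IsLocalRing R]

/-- If `Ext^i(k, M) = 0` for all `i ≥ n`, where `k` is the residue field and `M` is finitely
generated, then `Ext^i(R/p, M) = 0` for all primes `p` and all `i ≥ n`. By Noetherian induction the
claim holds for all primes strictly containing `p`, hence for `R/(p + xR)` with `x ∈ 𝔪 \ p`, and
Nakayama's lemma yields it for `R/p`. -/
lemma extVanishes_quotient_prime {M : Type u} [AddCommGroup M] [Module R M] [Module.Finite R M]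
    {n : ℕ} (hk : ∀ i, n ≤ i → ExtVanishes R (R ⧸ IsLocalRing.maximalIdeal R) M i) (p : Ideal R) :
    p.IsPrime → ∀ i, n ≤ i → ExtVanishes R (R ⧸ p) M i := by
  induction p using WellFoundedGT.induction with
  | ind p ih =>
    intro hp i hi
    by_cases hpm : p = IsLocalRing.maximalIdeal R
    · subst hpm
      exact hk i hi
    obtain ⟨x, hxm, hxp⟩ := Set.exists_of_ssubset
      (lt_of_le_of_ne (IsLocalRing.le_maximalIdeal hp.ne_top) fun h =>
        hpm (SetLike.coe_injective h))
    have hreg : IsSMulRegular (R ⧸ p) x := fun a b hab => by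
      have h0 : Ideal.Quotient.mk p x * (a - b) = 0 := by
        rw [mul_sub, sub_eq_zero]
        simpa [Algebra.smul_def] using hab
      rcases mul_eq_zero.mp h0 with h | h
      · exact absurd (Ideal.Quotient.eq_zero_iff_mem.mp h) hxp
      · exact sub_eq_zero.mp h
    -- vanishing for all finitely generated modules killed by `p` and `x`
    have key : ∀ N : Type u, ∀ [AddCommGroup N] [Module R N] [Module.Finite R N],
        p ≤ Module.annihilator R N → x ∈ Module.annihilator R N → ∀ j, n ≤ j →
          ExtVanishes R N M j := by
      intro N _ _ hN
      induction hN using IsNoetherianRing.induction_on_isQuotientEquivQuotientPrime R with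
      | subsingleton N => exact fun _ _ j _ => ExtVanishes.of_subsingleton j
      | quotient N q e =>
        intro hpN hxN j hj
        rw [e.annihilator_eq, Ideal.annihilator_quotient] at hpN hxN
        exact (ih q.1 (lt_of_le_of_ne hpN fun h => hxp (h ▸ hxN)) q.2 j hj).of_equiv e
      | exact N₁ N₂ N₃ f g hf hg h h₁ h₃ =>
        intro hpN hxN j hj
        have a₁ := f.annihilator_le_of_injective hf
        have a₃ := g.annihilator_le_of_surjective hg
        exact .mid hf h hg (h₁ (hpN.trans a₁) (a₁ hxN) j hj) (h₃ (hpN.trans a₃) (a₃ hxN) j hj)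
    refine ExtVanishes.of_regular_quotient hxm hreg
      (LinearMap.range (x • LinearMap.id : (R ⧸ p) →ₗ[R] R ⧸ p)).mkQ
      (Submodule.mkQ_surjective _) (LinearMap.exact_map_mkQ_range _)
      (key _ ?_ ?_ (i + 1) (by lia))
    · refine le_trans ?_ ((Submodule.mkQ _).annihilator_le_of_surjective
        (Submodule.mkQ_surjective _))
      rw [Ideal.annihilator_quotient]
    · refine Module.mem_annihilator.mpr fun a => ?_
      obtain ⟨a, rfl⟩ := Submodule.mkQ_surjective _ a
      rw [← map_smul]
      exact (Submodule.Quotient.mk_eq_zero _).mpr ⟨a, rfl⟩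

/-- If `Ext^i(k, M) = 0` for all `i ≥ n`, where `k` is the residue field and `M` is finitely
generated, then `Ext^i(N, M) = 0` for all finitely generated `N` and all `i ≥ n`. -/
lemma extVanishes_of_residueField {M : Type u} [AddCommGroup M] [Module R M] [Module.Finite R M]
    {n : ℕ} (hk : ∀ i, n ≤ i → ExtVanishes R (R ⧸ IsLocalRing.maximalIdeal R) M i)
    (N : Type u) [AddCommGroup N] [Module R N] [hN : Module.Finite R N] (i : ℕ) (hi : n ≤ i) :
    ExtVanishes R N M i := by
  induction hN using IsNoetherianRing.induction_on_isQuotientEquivQuotientPrime R with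
  | subsingleton N => exact ExtVanishes.of_subsingleton i
  | quotient N q e => exact (extVanishes_quotient_prime hk q.1 q.2 i hi).of_equiv e
  | exact N₁ N₂ N₃ f g hf hg h h₁ h₃ => exact .mid hf h hg h₁ h₃

end Detection

/-! ### The bound on the injective dimension -/

section Depth

open IsLocalRing
open scoped Pointwise

variable {R : Type u} [CommRing R] [IsNoetherianRing R] [IsLocalRing R]

omit [IsNoetherianRing R] in
lemma injective_of_residueField_of_ne_zero {N : Type u} [AddCommGroup N] [Module R N]
    (φ : (R ⧸ maximalIdeal R) →ₗ[R] N) (hφ : φ ≠ 0) : Function.Injective φ := by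
  have : IsSimpleModule R (R ⧸ maximalIdeal R) := isSimpleModule_iff_isCoatom.mpr
    (Ideal.isMaximal_def.mp (maximalIdeal.isMaximal R))
  exact (LinearMap.injective_or_eq_zero φ).resolve_right hφ

/-- Either some `x ∈ 𝔪` is a nonzerodivisor on the finitely generated module `N`, or `N` has depth
zero and the residue field embeds in `N`. -/
lemma exists_isSMulRegular_or_exists_injective (N : Type u) [AddCommGroup N] [Module R N]
    [Module.Finite R N] :
    (∃ x ∈ maximalIdeal R, IsSMulRegular N x) ∨
      ∃ φ : (R ⧸ maximalIdeal R) →ₗ[R] N, Function.Injective φ := by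
  by_cases h : Subsingleton ((R ⧸ maximalIdeal R) →ₗ[R] N)
  · left
    obtain ⟨x, hx, hreg⟩ := IsSMulRegular.subsingleton_linearMap_iff.mp h
    exact ⟨x, by rwa [Ideal.annihilator_quotient] at hx, hreg⟩
  · right
    have := not_subsingleton_iff_nontrivial.mp h
    obtain ⟨φ, hφ⟩ := exists_ne (0 : (R ⧸ maximalIdeal R) →ₗ[R] N)
    exact ⟨φ, injective_of_residueField_of_ne_zero φ hφ⟩

/-- The residue field embeds in a quotient `L` of `N` by a regular sequence, which has length at
most the dimension of `N`; hence the projective dimension of `L` exceeds that of `N` by at most the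
dimension of `N`. -/
lemma exists_residueField_injective (d : ℕ) : ∀ (N : Type u) [AddCommGroup N] [Module R N]
    [Module.Finite R N] [Nontrivial N], Module.supportDim R N ≤ d → ∀ c : ℕ,
    HasProjectiveDimensionLE (ModuleCat.of R N) c →
    ∃ (L : Type u) (_ : AddCommGroup L) (_ : Module R L)
      (φ : (R ⧸ maximalIdeal R) →ₗ[R] L), Module.Finite R L ∧ Function.Injective φ ∧
      HasProjectiveDimensionLE (ModuleCat.of R L) (c + d) := by
  induction d with
  | zero =>
    intro N _ _ _ _ hdim c hc
    rcases exists_isSMulRegular_or_exists_injective (R := R) N with ⟨x, hx, hreg⟩ | ⟨φ, hφ⟩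
    · have h1 := Module.supportDim_quotSMulTop_succ_eq_supportDim hreg hx
      have := nontrivial_quotSMulTop_of_mem_maximalIdeal N hx
      have h2 : Module.supportDim R (QuotSMulTop x N) ≠ ⊥ :=
        Module.supportDim_ne_bot_of_nontrivial R _
      rw [← h1] at hdim
      generalize Module.supportDim R (QuotSMulTop x N) = s at hdim h2
      induction s with
      | bot => exact absurd rfl h2
      | coe s =>
        have : s + 1 ≤ 0 := by exact_mod_cast hdim
        simp at this
    · exact ⟨N, _, _, φ, inferInstance, hφ, hasProjectiveDimensionLT_of_ge _ (c + 1) _ (by lia)⟩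
  | succ d ih =>
    intro N _ _ _ _ hdim c hc
    rcases exists_isSMulRegular_or_exists_injective (R := R) N with ⟨x, hx, hreg⟩ | ⟨φ, hφ⟩
    · have h1 := Module.supportDim_quotSMulTop_succ_eq_supportDim hreg hx
      have := nontrivial_quotSMulTop_of_mem_maximalIdeal N hx
      have hdim' : Module.supportDim R (QuotSMulTop x N) ≤ d := by
        rw [← h1] at hdim
        generalize Module.supportDim R (QuotSMulTop x N) = s at hdim
        induction s with
        | bot => exact bot_le
        | coe s =>
          have : s + 1 ≤ (d : ℕ∞) + 1 := by exact_mod_cast hdim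
          exact_mod_cast (ENat.add_le_add_iff_right (by simp)).mp this
      have hex : Function.Exact (x • LinearMap.id : N →ₗ[R] N)
          (Submodule.mkQ (x • (⊤ : Submodule R N))) := fun y => by
        rw [Submodule.mkQ_apply, Submodule.Quotient.mk_eq_zero,
          Submodule.mem_smul_pointwise_iff_exists]
        simp
      obtain ⟨L, i₁, i₂, φ, hfin, hφ, hL⟩ := ih (QuotSMulTop x N) hdim' (c + 1)
        ((shortExact_shortComplexOfExact (fun a b hab => hreg (by simpa using hab)) hex
          (Submodule.mkQ_surjective _)).hasProjectiveDimensionLT_X₃ (c + 1) hc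
          (hasProjectiveDimensionLT_of_ge _ (c + 1) _ (by lia)))
      exact ⟨L, i₁, i₂, φ, hfin, hφ, hasProjectiveDimensionLT_of_ge _ (c + 1 + d + 1) _ (by lia)⟩
    · exact ⟨N, _, _, φ, inferInstance, hφ, hasProjectiveDimensionLT_of_ge _ (c + 1) _ (by lia)⟩

/-- If `M` has finite injective dimension and the residue field `k` embeds in a finitely generated
module `L` with `Ext^i(L, M) = 0` for `i > d`, then `Ext^i(N, M) = 0` for all finitely generated
`N` and all `i > d`. By descending induction on `i`, the vanishing of `Ext^{i+1}(L/k, M)` gives that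
of `Ext^i(k, M)`. -/
lemma extVanishes_of_residueField_injective {M L : Type u} [AddCommGroup M] [Module R M]
    [Module.Finite R M] [AddCommGroup L] [Module R L] [Module.Finite R L]
    (hid : HasFiniteInjectiveDimension R M)
    (φ : (R ⧸ maximalIdeal R) →ₗ[R] L) (hφ : Function.Injective φ) {d : ℕ}
    (hL : ∀ i, d < i → ExtVanishes R L M i)
    (N : Type u) [AddCommGroup N] [Module R N] [Module.Finite R N] (i : ℕ) (hi : d < i) :
    ExtVanishes R N M i := by
  obtain ⟨n, hn⟩ := hid
  have key : ∀ m i, n < i + m → d < i → ExtVanishes R (R ⧸ maximalIdeal R) M i := by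
    intro m
    induction m with
    | zero => exact fun i h _ => .of_hasInjectiveDimensionLE hn h
    | succ m ih =>
      intro i _ hi
      exact .left hφ (LinearMap.exact_map_mkQ_range φ) (Submodule.mkQ_surjective _) (hL i hi)
        (extVanishes_of_residueField (n := i + 1) (fun j hj => ih j (by lia) (by lia)) _ _ le_rfl)
  exact extVanishes_of_residueField (n := i) (fun j hj => key (n + 1) j (by lia) (by lia)) _ _
    le_rfl

/-- Over a ring of dimension at most two, let `M` be finitely generated of finite injective
dimension. If `K` is finitely generated and torsion-free, then `Ext^i(K, M) = 0` for all `i ≥ 2`.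
If `𝔪` consists of zero-divisors, then `M` is injective; otherwise the injective dimension
of `M` is at most two and some `x ∈ 𝔪` is regular on `K`, so that `Ext^2(K, M) = 0` by Nakayama's
lemma. -/
lemma extVanishes_of_isTorsionFree (hdim : ringKrullDim R ≤ 2) {M : Type u} [AddCommGroup M]
    [Module R M] [Module.Finite R M] (hid : HasFiniteInjectiveDimension R M)
    (K : Type u) [AddCommGroup K] [Module R K] [Module.Finite R K] [Module.IsTorsionFree R K]
    (i : ℕ) (hi : 2 ≤ i) : ExtVanishes R K M i := by
  have hR : HasProjectiveDimensionLE (ModuleCat.of R R) 0 :=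
    hasProjectiveDimensionLE_zero_of_projective
  rcases exists_isSMulRegular_or_exists_injective (R := R) R with ⟨x, hx, hreg⟩ | ⟨φ, hφ⟩
  · obtain ⟨L, _, _, φ, _, hφ, hL⟩ := exists_residueField_injective (R := R) 2 R
      (by rw [Module.supportDim_self_eq_ringKrullDim]; exact_mod_cast hdim) 0 hR
    have h3 := extVanishes_of_residueField_injective hid φ hφ
      (fun j hj => .of_hasProjectiveDimensionLE hL (by lia)) (d := 2)
    have hregK : IsSMulRegular K x :=
      (isLeftRegular_iff_isRegular.mp (isLeftRegular_iff.mpr hreg)).isSMulRegular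
    exact .of_regular_quotient hx hregK (Submodule.mkQ _) (Submodule.mkQ_surjective _)
      (LinearMap.exact_map_mkQ_range _) (h3 _ (i + 1) (by lia))
  · exact extVanishes_of_residueField_injective hid φ hφ
      (fun j hj => .of_hasProjectiveDimensionLE hR hj) K i (by lia)

end Depth

/-! ### Totally reflexive modules -/

section TotallyReflexive

variable {R : Type u} [CommRing R] {A B C M X P Y : Type u} [AddCommGroup A] [Module R A]
  [AddCommGroup B] [Module R B] [AddCommGroup C] [Module R C] [AddCommGroup M] [Module R M]
  [AddCommGroup X] [Module R X] [AddCommGroup P] [Module R P] [AddCommGroup Y] [Module R Y]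

lemma exact_dualMap {f : A →ₗ[R] B} {g : B →ₗ[R] C} (h : Function.Exact f g)
    (hg : Function.Surjective g) : Function.Exact g.dualMap f.dualMap :=
  LinearMap.exact_lcomp_of_exact_of_surjective R h hg

lemma surjective_dualMap_of_extVanishes {f : A →ₗ[R] B} {g : B →ₗ[R] C}
    (hf : Function.Injective f) (h : Function.Exact f g) (hg : Function.Surjective g)
    (hC : ExtVanishes R C R 1) : Function.Surjective f.dualMap := fun φ =>
  ExtVanishes.exists_extension hf h hg hC φ

variable [IsNoetherianRing R]

omit [IsNoetherianRing R] in
/-- In a short exact sequence `0 → Y → F → X* → 0` with `F` free and `Ext^1(X*, R) = 0`, the module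
`Y` is reflexive. -/
lemma isReflexive_of_exact_dual {m : ℕ} {ι : Y →ₗ[R] (Fin m → R)}
    {π : (Fin m → R) →ₗ[R] Module.Dual R X} (hι : Function.Injective ι)
    (h : Function.Exact ι π) (hsurj : Function.Surjective ι.dualMap) : Module.IsReflexive R Y where
  bijective_dual_eval' := by
    refine ⟨(injective_iff_map_eq_zero _).mpr fun y hy => hι ?_, fun φ => ?_⟩
    · rw [map_zero]
      ext j
      exact LinearMap.congr_fun hy (LinearMap.proj j ∘ₗ ι)
    · obtain ⟨v, hv⟩ := (Module.bijective_dual_eval R (Fin m → R)).2 (φ ∘ₗ ι.dualMap)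
      have hv' : ∀ ζ : Module.Dual R (Fin m → R), ζ v = φ (ζ ∘ₗ ι) := fun ζ =>
        LinearMap.congr_fun hv ζ
      obtain ⟨y, rfl⟩ := (h v).mp (by
        ext x
        have := hv' (Module.Dual.eval R X x ∘ₗ π)
        rw [LinearMap.comp_assoc, h.linearMap_comp_eq_zero, LinearMap.comp_zero, map_zero] at this
        exact this)
      refine ⟨y, LinearMap.ext fun η => ?_⟩
      obtain ⟨ζ, rfl⟩ := hsurj η
      exact hv' ζ

lemma finite_dual_of_isNoetherianRing [Module.Finite R X] : Module.Finite R (Module.Dual R X) := by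
  obtain ⟨m, π, hπ⟩ := Module.Finite.exists_fin' R X
  exact Module.Finite.of_injective π.dualMap (LinearMap.dualMap_injective_of_surjective hπ)

namespace IsTotallyReflexive

/-- A totally reflexive module `X` embeds in a finite free module with totally reflexive cokernel:
this is the dual of a presentation `0 → Y → F → X* → 0` of the dual of `X`. -/
lemma exists_cosyzygy (hX : IsTotallyReflexive R X) :
    ∃ (F G : Type u) (_ : AddCommGroup F) (_ : Module R F) (_ : AddCommGroup G) (_ : Module R G)
      (f : X →ₗ[R] F) (g : F →ₗ[R] G), Module.Free R F ∧ Module.Finite R F ∧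
      Function.Injective f ∧ Function.Exact f g ∧ Function.Surjective g ∧
      IsTotallyReflexive R G := by
  have := hX.finite
  have := hX.isReflexive
  have := finite_dual_of_isNoetherianRing (R := R) (X := X)
  obtain ⟨m, π, hπ⟩ := Module.Finite.exists_fin' R (Module.Dual R X)
  let ι := (LinearMap.ker π).subtype
  have hι : Function.Injective ι := (LinearMap.ker π).injective_subtype
  have hex : Function.Exact ι π := π.exact_subtype_ker_map
  have hsurj : Function.Surjective ι.dualMap :=
    surjective_dualMap_of_extVanishes hι hex hπ (hX.ext_dual_eq_zero 1 le_rfl)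
  have hrefl := isReflexive_of_exact_dual hι hex hsurj
  let f : X →ₗ[R] Module.Dual R (Fin m → R) := π.dualMap ∘ₗ Module.Dual.eval R X
  have hf : Function.Injective f :=
    (LinearMap.dualMap_injective_of_surjective hπ).comp (Module.bijective_dual_eval R X).1
  have hfg : Function.Exact f ι.dualMap := fun ζ => by
    rw [exact_dualMap hex hπ ζ]
    constructor
    · rintro ⟨θ, rfl⟩
      obtain ⟨x, rfl⟩ := (Module.bijective_dual_eval R X).2 θ
      exact ⟨x, rfl⟩
    · rintro ⟨x, rfl⟩
      exact ⟨_, rfl⟩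
  refine ⟨Module.Dual R (Fin m → R), Module.Dual R (LinearMap.ker π), _, _, _, _, f, ι.dualMap,
    inferInstance, inferInstance, hf, hfg, hsurj, Module.Finite.of_surjective _ hsurj,
    inferInstance, fun i hi => ?_, fun i hi => ?_⟩
  · obtain ⟨i, rfl⟩ : ∃ j, i = j + 1 := ⟨i - 1, by lia⟩
    rcases Nat.eq_zero_or_pos i with rfl | hi
    · refine ExtVanishes.one_of_exists_extension hf hfg hsurj (.of_projective 0) fun φ => ?_
      obtain ⟨v, rfl⟩ := hπ φ
      exact ⟨Module.Dual.eval R _ v, rfl⟩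
    · exact ExtVanishes.right hf hfg hsurj (hX.ext_eq_zero i hi) (.of_projective i)
  · obtain ⟨i, rfl⟩ : ∃ j, i = j + 1 := ⟨i - 1, by lia⟩
    exact ExtVanishes.of_equiv (Module.evalEquiv R _).symm
      (ExtVanishes.left hι hex hπ (.of_projective i) (hX.ext_dual_eq_zero _ (by lia)))

/-- Totally reflexive modules are closed under extensions. -/
lemma of_exact {f : X →ₗ[R] P} {g : P →ₗ[R] Y} (hf : Function.Injective f)
    (h : Function.Exact f g) (hg : Function.Surjective g) (hX : IsTotallyReflexive R X)
    (hY : IsTotallyReflexive R Y) : IsTotallyReflexive R P := by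
  have := hX.finite
  have := hY.finite
  have := hX.isReflexive
  have := hY.isReflexive
  have hg' : Function.Injective g.dualMap := LinearMap.dualMap_injective_of_surjective hg
  have h' : Function.Exact g.dualMap f.dualMap := exact_dualMap h hg
  have hf' : Function.Surjective f.dualMap :=
    surjective_dualMap_of_extVanishes hf h hg (hY.ext_eq_zero 1 le_rfl)
  have : IsNoetherian R P := isNoetherian_of_range_eq_ker f g h.linearMap_ker_eq.symm
  refine ⟨inferInstance, ⟨(injective_iff_map_eq_zero _).mpr fun p hp => ?_, fun φ => ?_⟩,
    fun i hi => ExtVanishes.mid hf h hg (hX.ext_eq_zero i hi) (hY.ext_eq_zero i hi),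
    fun i hi => ExtVanishes.mid hg' h' hf' (hY.ext_dual_eq_zero i hi) (hX.ext_dual_eq_zero i hi)⟩
  · have hp' : ∀ ζ : Module.Dual R P, ζ p = 0 := fun ζ => LinearMap.congr_fun hp ζ
    obtain ⟨x, rfl⟩ := (h p).mp ((Module.bijective_dual_eval R Y).1 (by
      ext η
      simpa using hp' (η ∘ₗ g)))
    have : x = 0 := (Module.bijective_dual_eval R X).1 (by
      ext η
      obtain ⟨ζ, rfl⟩ := hf' η
      simpa using hp' ζ)
    rw [this, map_zero]
  · -- correct `φ` by a lift of its restriction to `Y*`; the difference comes from `X**`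
    obtain ⟨y, hy⟩ := (Module.bijective_dual_eval R Y).2 (φ ∘ₗ g.dualMap)
    obtain ⟨p, rfl⟩ := hg y
    have hker : LinearMap.ker f.dualMap ≤ LinearMap.ker (φ - Module.Dual.eval R P p) := by
      intro ζ hζ
      obtain ⟨η, rfl⟩ := (h' ζ).mp hζ
      have : η (g p) = φ (g.dualMap η) := LinearMap.congr_fun hy η
      rw [LinearMap.mem_ker, LinearMap.sub_apply, sub_eq_zero, ← this]
      rfl
    let ψ : Module.Dual R (Module.Dual R X) :=
      (LinearMap.ker f.dualMap).liftQ _ hker ∘ₗ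
        (f.dualMap.quotKerEquivOfSurjective hf').symm.toLinearMap
    have hψ : ∀ ζ, ψ (f.dualMap ζ) = φ ζ - ζ p := fun ζ => by
      have : (f.dualMap.quotKerEquivOfSurjective hf').symm (f.dualMap ζ) =
          (LinearMap.ker f.dualMap).mkQ ζ := by
        rw [LinearEquiv.symm_apply_eq]; rfl
      simp only [ψ, LinearMap.comp_apply, LinearEquiv.coe_coe]
      rw [this]
      rfl
    obtain ⟨x, hx⟩ := (Module.bijective_dual_eval R X).2 ψ
    refine ⟨f x + p, LinearMap.ext fun ζ => ?_⟩
    have : ζ (f x) = ψ (f.dualMap ζ) := LinearMap.congr_fun hx (f.dualMap ζ)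
    rw [Module.Dual.eval_apply, map_add, this, hψ, sub_add_cancel]

/-- `Ext^i(X, M) = 0` for all `i ≥ 1` if `X` is totally reflexive and `M` has finite injective
dimension, since `X` is a syzygy of arbitrarily high order of totally reflexive modules. -/
lemma extVanishes (hX : IsTotallyReflexive R X) (hid : HasFiniteInjectiveDimension R M) (i : ℕ)
    (hi : 1 ≤ i) : ExtVanishes R X M i := by
  obtain ⟨n, hn⟩ := hid
  have key : ∀ k : ℕ, ∀ (X : Type u) [AddCommGroup X] [Module R X], IsTotallyReflexive R X →
      ∀ i, 1 ≤ i → n < i + k → ExtVanishes R X M i := by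
    intro k
    induction k with
    | zero => exact fun X _ _ _ i _ h => .of_hasInjectiveDimensionLE hn h
    | succ k ih =>
      intro X _ _ hX i hi hik
      obtain ⟨F, G, _, _, _, _, f, g, _, _, hf, h, hg, hG⟩ := hX.exists_cosyzygy
      obtain ⟨i, rfl⟩ : ∃ j, i = j + 1 := ⟨i - 1, by lia⟩
      exact .left hf h hg (.of_projective i) (ih G hG (i + 2) (by lia) (by lia))
  exact key (n + 1) X hX i hi (by lia)

end IsTotallyReflexive

end TotallyReflexive

/-! ### Hulls of finite projective dimension -/

section Hull

variable {R : Type u} [CommRing R] {A B C D P : Type u} [AddCommGroup A] [Module R A]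
  [AddCommGroup B] [Module R B] [AddCommGroup C] [Module R C] [AddCommGroup D] [Module R D]
  [AddCommGroup P] [Module R P]

/-- The maps `u : B → P` and `v : C → P` form a pushout of `a : A → B` and `b : A → C`. -/
structure IsModulePushout (a : A →ₗ[R] B) (b : A →ₗ[R] C) (u : B →ₗ[R] P) (v : C →ₗ[R] P) :
    Prop where
  eq_iff : ∀ x y, u x = v y ↔ ∃ k, a k = x ∧ b k = y
  exists_add : ∀ p, ∃ x y, p = u x + v y

lemma exists_isModulePushout (a : A →ₗ[R] B) (b : A →ₗ[R] C) :
    ∃ (P : Type u) (_ : AddCommGroup P) (_ : Module R P) (u : B →ₗ[R] P) (v : C →ₗ[R] P),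
      IsModulePushout a b u v := by
  let q := (LinearMap.range (a.prod (-b))).mkQ
  refine ⟨_, _, _, q ∘ₗ LinearMap.inl R B C, q ∘ₗ LinearMap.inr R B C, fun x y => ?_, fun p => ?_⟩
  · rw [← sub_eq_zero, LinearMap.comp_apply, LinearMap.comp_apply, ← map_sub]
    change Submodule.Quotient.mk _ = _ ↔ _
    rw [Submodule.Quotient.mk_eq_zero, LinearMap.mem_range]
    simp [Prod.ext_iff]
  · obtain ⟨⟨x, y⟩, rfl⟩ := Submodule.mkQ_surjective _ p
    refine ⟨x, y, ?_⟩
    rw [LinearMap.comp_apply, LinearMap.comp_apply, ← map_add]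
    simp [q]

namespace IsModulePushout

variable {a : A →ₗ[R] B} {b : A →ₗ[R] C} {u : B →ₗ[R] P} {v : C →ₗ[R] P}

lemma symm (h : IsModulePushout a b u v) : IsModulePushout b a v u where
  eq_iff x y := by
    rw [eq_comm, h.eq_iff]
    exact exists_congr fun _ => and_comm
  exists_add p := by
    obtain ⟨x, y, rfl⟩ := h.exists_add p
    exact ⟨y, x, add_comm _ _⟩

lemma comm (h : IsModulePushout a b u v) (k : A) : u (a k) = v (b k) :=
  (h.eq_iff _ _).mpr ⟨k, rfl, rfl⟩

/-- A pushout of an injection is an injection with the same cokernel. -/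
lemma exists_exact (h : IsModulePushout a b u v) (hb : Function.Injective b) {g : C →ₗ[R] D}
    (hbg : Function.Exact b g) (hg : Function.Surjective g) :
    Function.Injective u ∧ ∃ s : P →ₗ[R] D, Function.Exact u s ∧ Function.Surjective s := by
  have hu : Function.Injective u := (injective_iff_map_eq_zero u).mpr fun x hx => by
    obtain ⟨k, rfl, hk⟩ := (h.eq_iff x 0).mp (by rw [hx, map_zero])
    rw [hb (hk.trans b.map_zero.symm), map_zero]
  -- the cokernel of `u` is the quotient of `C` by the image of `b`
  let q := (LinearMap.range u).mkQ
  have hq : ∀ p, q p = 0 ↔ ∃ x, u x = p := fun p => by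
    simp [q]
  have hqv : ∀ y, q (v y) = 0 ↔ g y = 0 := fun y => by
    rw [hq, hbg y]
    constructor
    · rintro ⟨x, hx⟩
      obtain ⟨k, _, hk⟩ := (h.eq_iff x y).mp hx
      exact ⟨k, hk⟩
    · rintro ⟨k, rfl⟩
      exact ⟨a k, h.comm k⟩
  have hqvs : Function.Surjective (q ∘ₗ v) := fun z => by
    obtain ⟨p, rfl⟩ := Submodule.mkQ_surjective _ z
    obtain ⟨x, y, rfl⟩ := h.exists_add p
    exact ⟨y, by rw [map_add, (hq (u x)).mpr ⟨x, rfl⟩, zero_add]; rfl⟩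
  have hker : LinearMap.ker (q ∘ₗ v) = LinearMap.ker g := by
    ext y
    exact hqv y
  let e := ((q ∘ₗ v).quotKerEquivOfSurjective hqvs).symm.trans
    ((Submodule.quotEquivOfEq _ _ hker).trans (g.quotKerEquivOfSurjective hg))
  refine ⟨hu, e.toLinearMap ∘ₗ q, fun p => ?_, e.surjective.comp (Submodule.mkQ_surjective _)⟩
  rw [LinearMap.comp_apply, LinearEquiv.coe_coe, LinearEquiv.map_eq_zero_iff, hq]
  rfl

/-- A pushout of a surjection is a surjection, whose kernel is the image of the original kernel. -/
lemma exact_of_surjective (h : IsModulePushout a b u v) (ha : Function.Surjective a)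
    {c : D →ₗ[R] A} (hca : Function.Exact c a) :
    Function.Surjective v ∧ Function.Exact (b ∘ₗ c) v := by
  refine ⟨fun p => ?_, fun y => ?_⟩
  · obtain ⟨x, y, rfl⟩ := h.exists_add p
    obtain ⟨k, rfl⟩ := ha x
    exact ⟨b k + y, by rw [map_add, h.comm]⟩
  · constructor
    · intro hy
      obtain ⟨k, hk, rfl⟩ := (h.eq_iff 0 y).mp (by rw [hy, map_zero])
      obtain ⟨d, rfl⟩ := (hca k).mp hk
      exact ⟨d, rfl⟩
    · rintro ⟨d, rfl⟩
      rw [LinearMap.comp_apply, ← h.comm, hca.apply_apply_eq_zero, map_zero]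

end IsModulePushout

/-- A module `K` of finite Gorenstein dimension embeds in a module `H` of finite projective
dimension with totally reflexive cokernel. Given `0 → K' → X → K → 0` with `X` totally reflexive and
such an embedding `K' → H'`, the pushout `P` of `X` and `H'` along `K'` is totally reflexive as an
extension, so it embeds in a free module `F` with totally reflexive cokernel, and `H = F/H'` is the
pushout of `F` and `K = P/H'` along `P`. -/
lemma exists_hull [IsNoetherianRing R] (n : ℕ) : ∀ (K : Type u) [AddCommGroup K] [Module R K],
    HasGorensteinDimensionLE R n K →
    ∃ (H G : Type u) (_ : AddCommGroup H) (_ : Module R H) (_ : AddCommGroup G) (_ : Module R G)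
      (f : K →ₗ[R] H) (g : H →ₗ[R] G), Function.Injective f ∧ Function.Exact f g ∧
      Function.Surjective g ∧ IsTotallyReflexive R G ∧
      HasProjectiveDimensionLE (ModuleCat.of R H) n := by
  induction n with
  | zero =>
    intro K _ _ hK
    obtain ⟨F, G, _, _, _, _, f, g, _, _, hf, h, hg, hG⟩ :=
      IsTotallyReflexive.exists_cosyzygy (R := R) (X := K) hK
    exact ⟨F, G, _, _, _, _, f, g, hf, h, hg, hG, hasProjectiveDimensionLE_zero_of_projective⟩
  | succ n ih =>
    rintro K _ _ ⟨X, t, hX, ht, hker⟩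
    obtain ⟨H', G', _, _, _, _, j, g', hj, hjg', hg', hG', hH'⟩ := ih _ hker
    obtain ⟨P, _, _, u, v, hP⟩ := exists_isModulePushout (LinearMap.ker t).subtype j
    obtain ⟨hu, s, hus, hs⟩ := hP.exists_exact hj hjg' hg'
    obtain ⟨hv, p, hvp, hp⟩ := hP.symm.exists_exact (LinearMap.ker t).injective_subtype
      t.exact_subtype_ker_map ht
    obtain ⟨F, G, _, _, _, _, w, y, _, _, hw, hwy, hy, hG⟩ :=
      (hX.of_exact hu hus hs hG').exists_cosyzygy
    obtain ⟨H, _, _, f, e, hH⟩ := exists_isModulePushout p w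
    obtain ⟨hf, g, hfg, hg⟩ := hH.exists_exact hw hwy hy
    obtain ⟨he, hwe⟩ := hH.exact_of_surjective hp hvp
    have hF : HasProjectiveDimensionLE (ModuleCat.of R F) 0 :=
      hasProjectiveDimensionLE_zero_of_projective
    exact ⟨H, G, _, _, _, _, f, g, hf, hfg, hg, hG,
      (shortExact_shortComplexOfExact (f := w ∘ₗ v) (hw.comp hv) hwe he).hasProjectiveDimensionLT_X₃
        (n + 1) hH' (hasProjectiveDimensionLT_of_ge _ 1 _ (by lia))⟩

end Hull

/-! ### Syzygies and reducing sequences -/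

section Reducing

variable {R : Type u} [CommRing R] {A B C M N : Type u} [AddCommGroup A] [Module R A]
  [AddCommGroup B] [Module R B] [AddCommGroup C] [Module R C] [AddCommGroup M] [Module R M]
  [AddCommGroup N] [Module R N]

lemma isTorsionFree_of_exact {f : A →ₗ[R] B} {g : B →ₗ[R] C} (hf : Function.Injective f)
    (h : Function.Exact f g) [Module.IsTorsionFree R A] [Module.IsTorsionFree R C] :
    Module.IsTorsionFree R B where
  isSMulRegular r hr := by
    refine isSMulRegular_iff_right_eq_zero_of_smul.mpr fun b hb => ?_
    obtain ⟨a, rfl⟩ := (h b).mp (hr.isSMulRegular.right_eq_zero_of_smul (by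
      rw [← map_smul, hb, map_zero]))
    rw [hr.isSMulRegular.right_eq_zero_of_smul (hf (by rw [map_smul, hb, map_zero]) : r • a = 0),
      map_zero]

/-- `Ext^i(-, M)` vanishes on finite powers of a module on which it vanishes. -/
lemma ExtVanishes.pi {i : ℕ} (hN : ExtVanishes R N M i) (b : ℕ) :
    ExtVanishes R (Fin b → N) M i := by
  induction b with
  | zero => exact .of_subsingleton i
  | succ b ih =>
    let f : N →ₗ[R] Fin (b + 1) → N := LinearMap.single R (fun _ => N) 0
    let g : (Fin (b + 1) → N) →ₗ[R] Fin b → N := LinearMap.funLeft R N Fin.succ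
    refine ExtVanishes.mid (f := f) (g := g) (Pi.single_injective (M := fun _ => N) 0)
      (fun v => ?_) (fun v => ?_) hN ih
    · constructor
      · intro hv
        refine ⟨v 0, funext fun j => ?_⟩
        refine Fin.cases ?_ (fun j => ?_) j
        · exact Pi.single_eq_same (M := fun _ => N) 0 (v 0)
        · exact (Pi.single_eq_of_ne (M := fun _ => N) (Fin.succ_ne_zero j) (v 0)).trans
            (congrFun hv j).symm
      · rintro ⟨x, rfl⟩
        exact funext fun j => Pi.single_eq_of_ne (M := fun _ => N) (Fin.succ_ne_zero j) x
    · exact ⟨Fin.cons 0 v, rfl⟩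

variable [IsLocalRing R]

namespace IsSyzygy

lemma isTorsionFree (n : ℕ) : ∀ (K : Type u) [AddCommGroup K] [Module R K]
    [Module.IsTorsionFree R K], IsSyzygy R n K N → Module.IsTorsionFree R N := by
  induction n with
  | zero => exact fun K _ _ _ ⟨e⟩ => e.symm.injective.moduleIsTorsionFree _ e.symm.map_smul
  | succ n ih =>
    rintro K _ _ _ ⟨m, f, _, _, h⟩
    have : Module.IsTorsionFree R (LinearMap.ker f) :=
      (LinearMap.ker f).injective_subtype.moduleIsTorsionFree _ fun _ _ => rfl
    exact ih _ h

/-- Dimension shifting: `Ext^i(Ω^n K, M) = 0` if `Ext^{i+n}(K, M) = 0` and `i ≥ 1`. -/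
lemma extVanishes {i : ℕ} (n : ℕ) : ∀ (K : Type u) [AddCommGroup K] [Module R K],
    IsSyzygy R n K N → ExtVanishes R K M (i + 1 + n) → ExtVanishes R N M (i + 1) := by
  induction n with
  | zero => exact fun K _ _ ⟨e⟩ hK => hK.of_equiv e.symm
  | succ n ih =>
    rintro K _ _ ⟨m, f, hf, _, h⟩ hK
    refine ih _ h ?_
    have : i + 1 + n = i + n + 1 := by lia
    rw [this]
    refine .left (LinearMap.ker f).injective_subtype f.exact_subtype_ker_map hf
      (.of_projective (i + n)) ?_
    convert hK using 1
    lia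

end IsSyzygy

/-- If `Ext^i(K, M) = 0` for all `i ≥ 2` and `M` is a retract of `K`, then `M` is a retract of the
module `L` obtained from `K` by a reducing step: the obstruction to extending a retraction
`K^a → M` to `L` lies in `Ext^1(Ω^n K, M)^b = Ext^{n+1}(K, M)^b`. -/
lemma IsReducingStep.exists_retract {K L : Type u} [AddCommGroup K] [Module R K] [AddCommGroup L]
    [Module R L] (h : IsReducingStep R K L) (hK : ∀ i, 2 ≤ i → ExtVanishes R K M i)
    (ι : M →ₗ[R] K) (ρ : K →ₗ[R] M) (hρ : ρ ∘ₗ ι = .id) :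
    ∃ (ι' : M →ₗ[R] L) (ρ' : L →ₗ[R] M), ρ' ∘ₗ ι' = .id := by
  obtain ⟨a, b, n, S, f, g, ha, hb, hn, hS, hf, hfg, hg⟩ := h
  obtain ⟨n, rfl⟩ : ∃ j, n = j + 1 := ⟨n - 1, by lia⟩
  have hS1 : ExtVanishes R S M 1 := IsSyzygy.extVanishes (i := 0) (n + 1) K hS (hK _ (by lia))
  let j₀ : Fin a := ⟨0, ha⟩
  obtain ⟨ψ, hψ⟩ := ExtVanishes.exists_extension hf hfg hg (hS1.pi b) (ρ ∘ₗ LinearMap.proj j₀)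
  refine ⟨f ∘ₗ LinearMap.single R (fun _ => K) j₀ ∘ₗ ι, ψ, ?_⟩
  rw [← LinearMap.comp_assoc, hψ]
  ext x
  simpa using LinearMap.congr_fun hρ x

lemma IsReducingStep.isTorsionFree {K L : Type u} [AddCommGroup K] [Module R K] [AddCommGroup L]
    [Module R L] (h : IsReducingStep R K L) [Module.IsTorsionFree R K] :
    Module.IsTorsionFree R L := by
  obtain ⟨a, b, n, S, f, g, _, _, _, hS, hf, hfg, _⟩ := h
  have := hS.isTorsionFree
  exact isTorsionFree_of_exact hf hfg

lemma exists_sequence_of_reducingGorensteinDimension_lt_top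
    (h : reducingGorensteinDimension R M < ⊤) :
    ∃ (r : ℕ) (K : Fin (r + 1) → ModuleCat.{u} R), IsReducingGorensteinSequence R M r K := by
  obtain ⟨r, hr⟩ := iInf_lt_iff.mp h
  obtain ⟨hK, _⟩ := iInf_lt_iff.mp hr
  exact ⟨r, hK⟩

/-- Over a ring of dimension at most two, a finitely generated torsion-free module `M` of finite
injective dimension is a retract of the last module of each of its reducing sequences. -/
lemma IsReducingGorensteinSequence.exists_retract_last [IsNoetherianRing R]
    (hdim : ringKrullDim R ≤ 2) [Module.Finite R M] [Module.IsTorsionFree R M]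
    (hid : HasFiniteInjectiveDimension R M) {r : ℕ} {K : Fin (r + 1) → ModuleCat.{u} R}
    (hK : IsReducingGorensteinSequence R M r K) :
    ∃ (ι : M →ₗ[R] K (Fin.last r)) (ρ : K (Fin.last r) →ₗ[R] M), ρ ∘ₗ ι = .id := by
  suffices ∀ i : Fin (r + 1), Module.IsTorsionFree R (K i) ∧
      ∃ (ι : M →ₗ[R] K i) (ρ : K i →ₗ[R] M), ρ ∘ₗ ι = .id from (this _).2
  intro i
  induction i using Fin.induction with
  | zero =>
    obtain ⟨e⟩ := hK.zero
    exact ⟨e.injective.moduleIsTorsionFree _ e.map_smul, e.symm.toLinearMap, e.toLinearMap,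
      by ext; simp⟩
  | succ i ih =>
    obtain ⟨_, ι, ρ, hρ⟩ := ih
    have := hK.finite i.castSucc
    exact ⟨(hK.step i).isTorsionFree, (hK.step i).exists_retract
      (fun j hj => extVanishes_of_isTorsionFree hdim hid _ j hj) ι ρ hρ⟩

end Reducing

/-- A module of finite injective dimension that is a retract of a module `K` of finite Gorenstein
dimension has finite projective dimension: the retraction extends to a hull `H` of `K`, as
`Ext^1` from the totally reflexive module `H/K` vanishes. -/
lemma exists_hasProjectiveDimensionLE_of_retract {R : Type u} [CommRing R] [IsNoetherianRing R]
    {M K : Type u} [AddCommGroup M] [Module R M] [AddCommGroup K] [Module R K]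
    (hid : HasFiniteInjectiveDimension R M) (hK : HasFiniteGorensteinDimension R K)
    (ι : M →ₗ[R] K) (ρ : K →ₗ[R] M) (hρ : ρ ∘ₗ ι = .id) :
    ∃ n, HasProjectiveDimensionLE (ModuleCat.of R M) n := by
  obtain ⟨n, hn⟩ := hK
  obtain ⟨H, G, _, _, _, _, f, g, hf, hfg, hg, hG, hH⟩ := exists_hull n K hn
  obtain ⟨ψ, hψ⟩ := ExtVanishes.exists_extension hf hfg hg (hG.extVanishes hid 1 le_rfl) ρ
  let re : Retract (ModuleCat.of R M) (ModuleCat.of R H) :=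
    { i := ModuleCat.ofHom (f ∘ₗ ι)
      r := ModuleCat.ofHom ψ
      retract := by
        rw [← ModuleCat.ofHom_comp, ← LinearMap.comp_assoc, hψ, hρ]
        rfl }
  exact ⟨n, re.hasProjectiveDimensionLT (n + 1)⟩

/-! ### Minimal covers -/

section MinimalCover

open IsLocalRing Abelian

variable {R : Type u} [CommRing R] [IsLocalRing R] {M N F Q : Type u} [AddCommGroup M] [Module R M]
  [AddCommGroup N] [Module R N] [AddCommGroup F] [Module R F] [AddCommGroup Q] [Module R Q]

/-- A finite free cover with the least number of generators is minimal. -/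
lemma exists_minimal_cover (Q : Type u) [AddCommGroup Q] [Module R Q] [Module.Finite R Q] :
    ∃ (m : ℕ) (π : (Fin m → R) →ₗ[R] Q), Function.Surjective π ∧
      LinearMap.ker π ≤ maximalIdeal R • (⊤ : Submodule R (Fin m → R)) := by
  classical
  have hex : ∃ m : ℕ, ∃ π : (Fin m → R) →ₗ[R] Q, Function.Surjective π :=
    Module.Finite.exists_fin' R Q
  obtain ⟨π, hπ⟩ := Nat.find_spec hex
  refine ⟨Nat.find hex, π, hπ, fun v hv => ?_⟩
  have hmem : ∀ j, v j ∈ maximalIdeal R := by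
    by_contra! hj
    obtain ⟨j, hj⟩ := hj
    have hu : IsUnit (v j) := by simpa using hj
    -- a unit coefficient `v j` in a relation makes the `j`-th generator redundant
    obtain ⟨m, hm⟩ : ∃ m, Nat.find hex = m + 1 := ⟨Nat.find hex - 1, by have := j.2; lia⟩
    refine Nat.find_min hex (m := m) (by lia) ?_
    generalize Nat.find hex = l at *
    subst hm
    let s : (Fin m → R) →ₗ[R] (Fin (m + 1) → R) :=
      { toFun := fun w => j.insertNth 0 w
        map_add' := fun w w' => by
          ext i
          refine Fin.succAboveCases j ?_ (fun i => ?_) i <;> simp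
        map_smul' := fun c w => by
          ext i
          refine Fin.succAboveCases j ?_ (fun i => ?_) i <;> simp }
    refine ⟨π ∘ₗ s, fun q => ?_⟩
    obtain ⟨w, rfl⟩ := hπ q
    obtain ⟨c, hc⟩ := hu.exists_right_inv
    refine ⟨fun i => (w - (w j * c) • v) (j.succAbove i), ?_⟩
    have : s (fun i => (w - (w j * c) • v) (j.succAbove i)) = w - (w j * c) • v := by
      ext i
      change (j.insertNth 0 (fun i => (w - (w j * c) • v) (j.succAbove i)) : Fin (m + 1) → R) i = _
      refine Fin.succAboveCases j ?_ (fun i => ?_) i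
      · simp only [Fin.insertNth_apply_same, Pi.sub_apply, Pi.smul_apply, smul_eq_mul]
        linear_combination (w j) * hc
      · simp
    rw [LinearMap.comp_apply, this, map_sub, map_smul, LinearMap.mem_ker.mp hv, smul_zero, sub_zero]
  rw [pi_eq_sum_univ v]
  exact Submodule.sum_mem _ fun j _ => Submodule.smul_mem_smul (hmem j) trivial

/-- If `Q` has finite projective dimension and `Ext^i(Q, M) = 0` for all `i ≥ 1`, where `M` is a
nonzero finitely generated module, then `Q` is free. By induction, the kernel `N` of a minimal cover
`F → Q` is free. Every map `N → M` extends to `F`, hence has image in `𝔪M`, which forces `N = 0`. -/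
lemma free_of_extVanishes [IsNoetherianRing R] [Module.Finite R M] [Nontrivial M] (n : ℕ) :
    ∀ (Q : Type u) [AddCommGroup Q] [Module R Q] [Module.Finite R Q],
      HasProjectiveDimensionLE (ModuleCat.of R Q) n → (∀ i, 1 ≤ i → ExtVanishes R Q M i) →
      Module.Free R Q := by
  induction n with
  | zero =>
    intro Q _ _ _ hpd _
    have : Module.Projective R Q := (IsProjective.iff_projective Q).mpr
      (projective_iff_hasProjectiveDimensionLT_one.mpr hpd)
    exact Module.free_of_flat_of_isLocalRing
  | succ n ih =>
    intro Q _ _ _ hpd hQ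
    obtain ⟨m, π, hπ, hker⟩ := exists_minimal_cover (R := R) Q
    have hι := (LinearMap.ker π).injective_subtype
    have hex := π.exact_subtype_ker_map
    have hF : HasProjectiveDimensionLE (ModuleCat.of R (Fin m → R)) 0 :=
      hasProjectiveDimensionLE_zero_of_projective
    have hfree : Module.Free R (LinearMap.ker π) := ih _
      ((shortExact_shortComplexOfExact hι hex hπ).hasProjectiveDimensionLT_X₁ (n + 1)
        (hasProjectiveDimensionLT_of_ge _ 1 _ (by lia)) hpd) fun i hi => by
        obtain ⟨i, rfl⟩ : ∃ j, i = j + 1 := ⟨i - 1, by lia⟩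
        exact .left hι hex hπ (.of_projective i) (hQ _ (by lia))
    let b := Module.Free.chooseBasis R (LinearMap.ker π)
    have hempty : IsEmpty (Module.Free.ChooseBasisIndex R (LinearMap.ker π)) := by
      refine ⟨fun j => ?_⟩
      have hM : (⊤ : Submodule R M) ≠ maximalIdeal R • ⊤ :=
        Submodule.top_ne_ideal_smul_of_le_jacobson_annihilator (maximalIdeal_le_jacobson _)
      refine hM (le_antisymm (fun y _ => ?_) le_top)
      obtain ⟨ψ, hψ⟩ := ExtVanishes.exists_extension hι hex hπ (hQ 1 le_rfl)
        (b.constr R fun _ => y)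
      have hy : ψ (b j : Fin m → R) = y := by
        have := LinearMap.congr_fun hψ (b j)
        rwa [Module.Basis.constr_basis] at this
      rw [← hy]
      have := Submodule.mem_map_of_mem (f := ψ) (hker (b j).2)
      rw [Submodule.map_smul''] at this
      exact Submodule.smul_mono le_rfl le_top this
    have hbot : LinearMap.ker π = ⊥ := by
      have : Subsingleton (LinearMap.ker π) := b.repr.toEquiv.subsingleton
      exact Submodule.subsingleton_iff_eq_bot.mp this
    exact Module.Free.of_equiv (LinearEquiv.ofBijective π ⟨LinearMap.ker_eq_bot.mp hbot, hπ⟩)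

lemma smul_ext_residueField_eq_zero {r : R} (hr : r ∈ maximalIdeal R) {i : ℕ}
    (e : Ext (ModuleCat.of R (R ⧸ maximalIdeal R)) (ModuleCat.of R F) i) : r • e = 0 := by
  have h0 : r • 𝟙 (ModuleCat.of R (R ⧸ maximalIdeal R)) = 0 := by
    refine ModuleCat.hom_ext (LinearMap.ext fun x => ?_)
    obtain ⟨x, rfl⟩ := Ideal.Quotient.mk_surjective x
    change r • Ideal.Quotient.mk (maximalIdeal R) x = 0
    rw [Algebra.smul_def]
    exact Ideal.Quotient.eq_zero_iff_mem.mpr (Ideal.mul_mem_right _ _ hr)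
  rw [← Ext.mk₀_id_comp e, ← Ext.smul_comp, ← Ext.mk₀_smul, h0, Ext.mk₀_zero, Ext.zero_comp]

/-- A linear map from a finite free module to `F` with image in `𝔪F` induces the zero map on
`Ext^i(k, -)`, as its matrix entries annihilate the residue field `k`. -/
lemma ext_residueField_comp_eq_zero [Module.Free R N] [Module.Finite R N] (φ : N →ₗ[R] F)
    (hφ : LinearMap.range φ ≤ maximalIdeal R • ⊤) {i : ℕ}
    (e : Ext (ModuleCat.of R (R ⧸ maximalIdeal R)) (ModuleCat.of R N) i) :
    e.comp (Ext.mk₀ (ModuleCat.ofHom φ)) (add_zero i) = 0 := by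
  have key : ∀ v ∈ maximalIdeal R • (⊤ : Submodule R F), ∀ c : N →ₗ[R] R,
      e.comp (Ext.mk₀ (ModuleCat.ofHom (c.smulRight v))) (add_zero i) = 0 := by
    intro v hv c
    induction hv using Submodule.smul_induction_on' with
    | smul r hr w _ =>
      have : ModuleCat.ofHom (c.smulRight (r • w)) = r • ModuleCat.ofHom (c.smulRight w) := by
        ext x
        exact smul_comm _ _ _
      rw [this, Ext.mk₀_smul, Ext.comp_smul, smul_ext_residueField_eq_zero hr]
    | add v _ w _ hv hw =>
      have : ModuleCat.ofHom (c.smulRight (v + w)) =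
          ModuleCat.ofHom (c.smulRight v) + ModuleCat.ofHom (c.smulRight w) := by
        ext x
        exact smul_add _ _ _
      rw [this, Ext.mk₀_add, Ext.comp_add, hv, hw, add_zero]
  let b := Module.Free.chooseBasis R N
  have hsum : ModuleCat.ofHom φ =
      ∑ j, ModuleCat.ofHom ((b.coord j).smulRight (φ (b j))) := by
    refine ModuleCat.hom_ext ?_
    rw [ModuleCat.hom_sum]
    refine b.ext fun l => ?_
    simp [LinearMap.sum_apply, Finsupp.single_apply]
  rw [hsum, Ext.mk₀_sum, Ext.comp_sum]
  exact Finset.sum_eq_zero fun j _ => key _ (hφ ⟨_, rfl⟩) _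

/-- A Noetherian local ring with a nonzero finitely generated module `M` of finite injective
dimension, of finite projective dimension and with `Ext^i(M, M) = 0` for `i ≥ 2` is Gorenstein. The
minimal resolution `0 → N → F → M → 0` has length one, so `Ext^i(k, F)` embeds in `Ext^i(k, M)`,
which vanishes for large `i`. -/
lemma isGorensteinLocalRing_of_hasProjectiveDimensionLE [IsNoetherianRing R] [Module.Finite R M]
    [Nontrivial M] (hid : HasFiniteInjectiveDimension R M) {n : ℕ}
    (hpd : HasProjectiveDimensionLE (ModuleCat.of R M) n)
    (hM : ∀ i, 2 ≤ i → ExtVanishes R M M i) : IsGorensteinLocalRing R := by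
  obtain ⟨m, π, hπ, hker⟩ := exists_minimal_cover (R := R) M
  have hι := (LinearMap.ker π).injective_subtype
  have hex := π.exact_subtype_ker_map
  have hF : HasProjectiveDimensionLE (ModuleCat.of R (Fin m → R)) 0 :=
    hasProjectiveDimensionLE_zero_of_projective
  have hN : HasProjectiveDimensionLE (ModuleCat.of R (LinearMap.ker π)) n :=
    (shortExact_shortComplexOfExact hι hex hπ).hasProjectiveDimensionLT_X₁ (n + 1)
      (hasProjectiveDimensionLT_of_ge _ 1 _ (by lia))
      (hasProjectiveDimensionLT_of_ge _ (n + 1) _ (by lia))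
  have : Module.Free R (LinearMap.ker π) := free_of_extVanishes (M := M) n _ hN fun i hi => by
    obtain ⟨i, rfl⟩ : ∃ j, i = j + 1 := ⟨i - 1, by lia⟩
    exact .left hι hex hπ (.of_projective i) (hM _ (by lia))
  obtain ⟨d, hd⟩ := hid
  have hkF : ∀ i, d + 1 ≤ i → ExtVanishes R (R ⧸ maximalIdeal R) (Fin m → R) i := by
    refine fun i hi => subsingleton_of_forall_eq 0 fun e => ?_
    have hkM : ExtVanishes R (R ⧸ maximalIdeal R) M i := .of_hasInjectiveDimensionLE hd (by lia)
    obtain ⟨x, rfl⟩ := Ext.covariant_sequence_exact₂ _ (shortExact_shortComplexOfExact hι hex hπ) e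
      (hkM.elim _ _)
    exact ext_residueField_comp_eq_zero _ (by rwa [Submodule.range_subtype]) x
  have hm : 0 < m := by
    rw [Nat.pos_iff_ne_zero]
    rintro rfl
    exact not_subsingleton M hπ.subsingleton
  have hkR : ∀ i, d + 1 ≤ i → ExtVanishes R (R ⧸ maximalIdeal R) R i := fun i hi =>
    .covariant_of_retract (LinearMap.single R (fun _ => R) (⟨0, hm⟩ : Fin m))
      (LinearMap.proj (⟨0, hm⟩ : Fin m)) (by ext; simp) (hkF i hi)
  exact ⟨inferInstance, inferInstance, d, hasInjectiveDimensionLE_of_extVanishes_quotient d R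
    fun I => extVanishes_of_residueField hkR _ _ le_rfl⟩

end MinimalCover

theorem mainTheorem2 (R : Type u) [CommRing R] [IsNoetherianRing R] [IsLocalRing R]
    (hdim : ringKrullDim R = 2)
    (M : Type u) [AddCommGroup M] [Module R M] [Module.Finite R M] [Nontrivial M]
    [Module.IsTorsionFree R M]
    (hid : HasFiniteInjectiveDimension R M)
    (hrG : reducingGorensteinDimension R M < ⊤) :
    IsGorensteinLocalRing R := by
  obtain ⟨r, K, hK⟩ := exists_sequence_of_reducingGorensteinDimension_lt_top hrG
  obtain ⟨ι, ρ, hρ⟩ := hK.exists_retract_last hdim.le hid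
  obtain ⟨n, hn⟩ := exists_hasProjectiveDimensionLE_of_retract hid hK.last ι ρ hρ
  exact isGorensteinLocalRing_of_hasProjectiveDimensionLE hid hn
    fun i hi => extVanishes_of_isTorsionFree hdim.le hid M i hi
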